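/- Let $N\ge 1$ be an integer, $0<s<1$, $1<p<\frac{N}{s}$ and $0<\beta<\frac{N-ps}{2}$, and set $p^*_s=\frac{pN}{N-ps}$. Then there is a constant $S(\beta)>0$, depending only on $N,p,s,\beta$, such that for every real-valued $u\in\mathcal C_0^\infty(\mathbb R^N)$ (smooth with compact support, which may contain the origin), $$ \int_{\mathbb R^N}\int_{\mathbb R^N}\frac{|u(x)-u(y)|^p}{|x-y|^{N+ps}}\,\frac{dx}{|x|^\beta}\,\frac{dy}{|y|^\beta}\;\ge\; S(\beta)\left(\int_{\mathbb R^N}\frac{|u(x)|^{p^*_s}}{|x|^{2\beta p^*_s/p}}\,dx\right)^{p/p^*_s}. $$ Here $|\cdot|$ denotes the absolute value or the Euclidean norm on $\mathbb R^N$, and both sides are integrals of nonnegative measurable functions, taken in $[0,\infty]$. -/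

import Mathlib

open MeasureTheory
open scoped ENNReal ContDiff

/-- The fractional Sobolev critical exponent `p*_s = p N / (N - p s)`. -/
noncomputable def fracSobolevExponent (N : ℕ) (s p : ℝ) : ℝ :=
  p * N / (N - p * s)

/-- The weighted Gagliardo energy
`∬ |u(x) - u(y)|^p / (|x - y|^(N + p s) |x|^β |y|^β) dx dy`, a Lebesgue integral of a nonnegative
function with values in `[0, ∞]`. The diagonal and the points with `x = 0` or `y = 0`, where the
quotient is not meaningful, form a null set. -/
noncomputable def weightedGagliardoEnergy (N : ℕ) (s p β : ℝ)
    (u : EuclideanSpace ℝ (Fin N) → ℝ) : ℝ≥0∞ :=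
  ∫⁻ x, ∫⁻ y, ENNReal.ofReal
    (|u x - u y| ^ p / (‖x - y‖ ^ ((N : ℝ) + p * s) * ‖x‖ ^ β * ‖y‖ ^ β))

/-- The weighted Lebesgue integral `∫ |u(x)|^(p*_s) / |x|^(2 β p*_s / p) dx`, in `[0, ∞]`. -/
noncomputable def weightedCriticalIntegral (N : ℕ) (s p β : ℝ)
    (u : EuclideanSpace ℝ (Fin N) → ℝ) : ℝ≥0∞ :=
  ∫⁻ x, ENNReal.ofReal
    (|u x| ^ fracSobolevExponent N s p / ‖x‖ ^ (2 * β * (fracSobolevExponent N s p / p)))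

/-! The argument is the truncation method. Put κ = p/p*_s = 1 − ps/N, γ = 2β/κ, μ = |x|^(−γ) dx and
A_i = {|u| > 2^i}. Up to constants, the weighted norm is at most Σ 2^(ip) μ(A_i)^κ, while the energy
dominates Σ 2^(ip) ∫_{A_i} ∫_{A_{i−1}ᶜ} K, with K the weighted kernel. It remains to compare the two
sums (`sobolev_of_nested_sets`). If μ(A_i) is a tiny fraction of μ(A_{i−1}), the i-th term of the
first sum is at most half the preceding one and is absorbed. Otherwise the set inequality
`exists_rpow_measure_le_interaction` bounds it by the i-th term of the second.

For the set inequality with A ⊆ F, let f = μ(F). Around x not too near the origin, a ball of radius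
ρ ~ (f|x|^γ)^(1/N) is at most half filled by F, so the rest of the ball gives ∫_{Fᶜ} K(x,y) dy ≳
ρ^(−ps) |x|^(−2β) = f^(−ps/N) |x|^(−γ) up to constants. Integrating over the part of A away from the
origin, whose μ-measure is still comparable to f, yields f^κ. The condition β < (N−ps)/2 says γ < N:
μ is finite near 0, and small balls at 0 can be discarded. -/

namespace ENNReal

/-! ### Dyadic sums in `ℝ≥0∞`. -/

lemma two_zpow_ne_zero (i : ℤ) : (2 : ℝ≥0∞) ^ i ≠ 0 :=
  (zpow_pos (by norm_num) (by norm_num) i).ne'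

lemma two_zpow_ne_top (i : ℤ) : (2 : ℝ≥0∞) ^ i ≠ ⊤ :=
  (zpow_lt_top (by norm_num) (by norm_num) i).ne

lemma two_zpow_add_one (i : ℤ) : (2 : ℝ≥0∞) ^ (i + 1) = 2 * 2 ^ i := by
  rw [ENNReal.zpow_add (by norm_num) (by norm_num), zpow_one, mul_comm]

/-- Only the exponents up to some n with 2^n < v contribute. Since p ≥ 1, the terms decay at least
like 2^(−j) below n. -/
lemma tsum_two_zpow_rpow_le {p : ℝ} (hp : 1 ≤ p) {v : ℝ≥0∞} (hv : v ≠ ⊤) :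
    ∑' i : ℤ, (if (2 : ℝ≥0∞) ^ i < v then ((2 : ℝ≥0∞) ^ i) ^ p else 0) ≤ 2 * v ^ p := by
  have hp0 : 0 ≤ p := by linarith
  rcases eq_or_ne v 0 with rfl | hv0
  · simp
  obtain ⟨n, hn1, hn2⟩ := exists_mem_Ioc_zpow hv0 hv (y := 2) (by norm_num) (by norm_num)
  have hinj : Function.Injective (fun j : ℕ => n - (j : ℤ)) := fun a b h => by
    simpa using h
  rw [← hinj.tsum_eq]
  · calc ∑' j : ℕ, (if (2 : ℝ≥0∞) ^ (n - (j : ℤ)) < v then ((2 : ℝ≥0∞) ^ (n - (j : ℤ))) ^ p else 0)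
        ≤ ∑' j : ℕ, v ^ p * (2⁻¹ : ℝ≥0∞) ^ j := by
          refine ENNReal.tsum_le_tsum fun j => ?_
          split_ifs
          · have h1 : (2 : ℝ≥0∞) ^ (n - (j : ℤ)) = 2 ^ n * (2⁻¹ : ℝ≥0∞) ^ j := by
              rw [sub_eq_add_neg, ENNReal.zpow_add (by norm_num) (by norm_num), ENNReal.zpow_neg, zpow_natCast,
                ENNReal.inv_pow]
            rw [h1, ENNReal.mul_rpow_of_nonneg _ _ hp0]
            gcongr
            have h2 : (2⁻¹ : ℝ≥0∞) ^ j ≤ 1 := pow_le_one' (by norm_num) j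
            simpa using ENNReal.rpow_le_rpow_of_exponent_ge h2 hp
          · exact zero_le
      _ = 2 * v ^ p := by
          rw [ENNReal.tsum_mul_left, ENNReal.tsum_geometric, ENNReal.one_sub_inv_two, inv_inv,
            mul_comm]
  · intro i hi
    have h1 : (2 : ℝ≥0∞) ^ i < v := by
      by_contra h
      simp [h] at hi
    have h2 : i < n + 1 := by
      by_contra! h
      exact absurd (h1.trans_le hn2) (not_lt.2 (zpow_le_of_le (by norm_num) h))
    exact ⟨(n - i).toNat, by simp only; omega⟩

lemma rpow_sum_le_sum_rpow {ι : Type*} (s : Finset ι) (f : ι → ℝ≥0∞) {κ : ℝ} (h0 : 0 < κ)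
    (h1 : κ ≤ 1) : (∑ i ∈ s, f i) ^ κ ≤ ∑ i ∈ s, f i ^ κ := by
  classical
  induction s using Finset.induction_on with
  | empty => simp [h0]
  | insert a s ha ih =>
    rw [Finset.sum_insert ha, Finset.sum_insert ha]
    exact (rpow_add_le_add_rpow _ _ h0.le h1).trans (by gcongr)

lemma rpow_tsum_le_tsum_rpow {ι : Type*} (f : ι → ℝ≥0∞) {κ : ℝ} (h0 : 0 < κ) (h1 : κ ≤ 1) :
    (∑' i, f i) ^ κ ≤ ∑' i, f i ^ κ := by
  have h : Filter.Tendsto (fun s : Finset ι => (∑ i ∈ s, f i) ^ κ) Filter.atTop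
      (nhds ((∑' i, f i) ^ κ)) :=
    (ENNReal.continuous_rpow_const.tendsto _).comp ENNReal.summable.hasSum
  exact le_of_tendsto' h fun s =>
    (rpow_sum_le_sum_rpow s f h0 h1).trans (ENNReal.sum_le_tsum s)

end ENNReal

/-! ### Truncation: from nested sets to functions. -/

section Dyadic

variable {X : Type*} [MeasurableSpace X]

/-- On its dyadic shell v is at most 2^(i+1); then t ↦ t^κ is subadditive because κ ≤ 1. -/
lemma rpow_lintegral_le_tsum_dyadic (μ : Measure X) {v : X → ℝ≥0∞} (hv : Measurable v)
    (hvtop : ∀ x, v x ≠ ⊤) {p κ : ℝ} (hp : 1 ≤ p) (h0 : 0 < κ) (h1 : κ ≤ 1) :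
    (∫⁻ x, v x ^ (p / κ) ∂μ) ^ κ ≤
      2 ^ p * ∑' i : ℤ, ((2 : ℝ≥0∞) ^ i) ^ p * μ {x | (2 : ℝ≥0∞) ^ i < v x} ^ κ := by
  have hq : 0 < p / κ := by positivity
  have hm : ∀ i : ℤ, MeasurableSet {x | (2 : ℝ≥0∞) ^ i < v x} := fun i =>
    measurableSet_lt measurable_const hv
  have hpt : ∀ x, v x ^ (p / κ) ≤ ∑' i : ℤ, {x | (2 : ℝ≥0∞) ^ i < v x}.indicator
      (fun _ => ((2 : ℝ≥0∞) ^ (i + 1)) ^ (p / κ)) x := by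
    intro x
    rcases eq_or_ne (v x) 0 with hx | hx
    · simp [hx, hq]
    obtain ⟨n, hn1, hn2⟩ := ENNReal.exists_mem_Ioc_zpow hx (hvtop x) (y := 2) (by norm_num)
      (by norm_num)
    refine le_trans ?_ (ENNReal.le_tsum n)
    rw [Set.indicator_of_mem (show x ∈ {x | (2 : ℝ≥0∞) ^ n < v x} from hn1)]
    gcongr
  have hle : ∫⁻ x, v x ^ (p / κ) ∂μ ≤
      ∑' i : ℤ, ((2 : ℝ≥0∞) ^ (i + 1)) ^ (p / κ) * μ {x | (2 : ℝ≥0∞) ^ i < v x} := by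
    refine (lintegral_mono hpt).trans (le_of_eq ?_)
    rw [lintegral_tsum fun i => (measurable_const.indicator (hm i)).aemeasurable]
    exact tsum_congr fun i => lintegral_indicator_const (hm i) _
  refine (ENNReal.rpow_le_rpow hle h0.le).trans ((ENNReal.rpow_tsum_le_tsum_rpow _ h0 h1).trans ?_)
  rw [← ENNReal.tsum_mul_left]
  refine ENNReal.tsum_le_tsum fun i => le_of_eq ?_
  rw [ENNReal.mul_rpow_of_nonneg _ _ h0.le, ← ENNReal.rpow_mul, div_mul_cancel₀ _ h0.ne',
    ENNReal.two_zpow_add_one, ENNReal.mul_rpow_of_nonneg _ _ (by linarith), mul_assoc]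

/-- The one-level gap forces |u x| ≥ 2|u y|, hence |u x| ≤ 2|u x − u y|. A fixed pair lies in many
of the product sets, but the weights 2^(ip) with 2^i < |u x| sum geometrically to at most 2|u x|^p.
-/
lemma tsum_dyadic_lintegral_le (ν : Measure X) {K : X → X → ℝ≥0∞}
    (hK : Measurable (Function.uncurry K)) [SFinite ν] {u : X → ℝ} (hu : Measurable u) {p : ℝ}
    (hp : 1 ≤ p) :
    ∑' i : ℤ, ((2 : ℝ≥0∞) ^ i) ^ p * ∫⁻ x in {x | (2 : ℝ≥0∞) ^ i < ENNReal.ofReal |u x|},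
        ∫⁻ y in {y | (2 : ℝ≥0∞) ^ (i - 1) < ENNReal.ofReal |u y|}ᶜ, K x y ∂ν ∂ν ≤
      2 * 2 ^ p * ∫⁻ x, ∫⁻ y, ENNReal.ofReal |u x - u y| ^ p * K x y ∂ν ∂ν := by
  have hp0 : 0 ≤ p := by linarith
  have hm : ∀ i : ℤ, MeasurableSet {x | (2 : ℝ≥0∞) ^ i < ENNReal.ofReal |u x|} := fun i =>
    measurableSet_lt measurable_const (by fun_prop)
  have hKx : ∀ x, Measurable (K x) := fun x => hK.comp measurable_prodMk_left
  set G : ℤ → X → X → ℝ≥0∞ := fun i x y =>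
    ({x | (2 : ℝ≥0∞) ^ i < ENNReal.ofReal |u x|} ×ˢ
      {y | (2 : ℝ≥0∞) ^ (i - 1) < ENNReal.ofReal |u y|}ᶜ).indicator
        (fun z => ((2 : ℝ≥0∞) ^ i) ^ p * K z.1 z.2) (x, y) with hG
  have hGm : ∀ i, Measurable (Function.uncurry (G i)) := fun i =>
    (measurable_const.mul hK).indicator ((hm i).prod (hm (i - 1)).compl)
  have hGx : ∀ i x, Measurable (G i x) := fun i x => (hGm i).comp measurable_prodMk_left
  have hterm : ∀ i : ℤ, ((2 : ℝ≥0∞) ^ i) ^ p *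
      ∫⁻ x in {x | (2 : ℝ≥0∞) ^ i < ENNReal.ofReal |u x|},
        ∫⁻ y in {y | (2 : ℝ≥0∞) ^ (i - 1) < ENNReal.ofReal |u y|}ᶜ, K x y ∂ν ∂ν =
      ∫⁻ x, ∫⁻ y, G i x y ∂ν ∂ν := by
    intro i
    rw [← lintegral_indicator (hm i), ← lintegral_const_mul']
    · refine lintegral_congr fun x => ?_
      by_cases hx : x ∈ {x | (2 : ℝ≥0∞) ^ i < ENNReal.ofReal |u x|}
      · rw [Set.indicator_of_mem hx, ← lintegral_indicator (hm (i - 1)).compl,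
          ← lintegral_const_mul _ ((hKx x).indicator (hm (i - 1)).compl)]
        refine lintegral_congr fun y => ?_
        by_cases hy : y ∈ {y | (2 : ℝ≥0∞) ^ (i - 1) < ENNReal.ofReal |u y|}ᶜ
        · rw [hG]
          simp only
          rw [Set.indicator_of_mem hy, Set.indicator_of_mem (Set.mk_mem_prod hx hy)]
        · rw [hG]
          simp only
          rw [Set.indicator_of_notMem hy, Set.indicator_of_notMem (fun h => hy h.2), mul_zero]
      · rw [Set.indicator_of_notMem hx, mul_zero]
        refine (lintegral_eq_zero_of_ae_eq_zero (ae_of_all _ fun y => ?_)).symm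
        exact Set.indicator_of_notMem (fun h => hx h.1) _
    · exact ENNReal.rpow_ne_top_of_nonneg hp0 (ENNReal.two_zpow_ne_top i)
  have hpt : ∀ x y, ∑' i, G i x y ≤ 2 * 2 ^ p * (ENNReal.ofReal |u x - u y| ^ p * K x y) := by
    intro x y
    by_cases hxy : 2 * |u y| ≤ |u x|
    · have h1 : ENNReal.ofReal |u x| ≤ 2 * ENNReal.ofReal |u x - u y| := by
        rw [show (2 : ℝ≥0∞) = ENNReal.ofReal 2 by simp, ← ENNReal.ofReal_mul (by norm_num)]
        refine ENNReal.ofReal_le_ofReal ?_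
        have := abs_sub_abs_le_abs_sub (u x) (u y)
        linarith
      calc ∑' i, G i x y ≤ ∑' i : ℤ, (if (2 : ℝ≥0∞) ^ i < ENNReal.ofReal |u x|
              then ((2 : ℝ≥0∞) ^ i) ^ p else 0) * K x y := by
            refine ENNReal.tsum_le_tsum fun i => ?_
            refine Set.indicator_apply_le' (fun h => ?_) (fun _ => zero_le)
            rw [if_pos (show (2 : ℝ≥0∞) ^ i < ENNReal.ofReal |u x| from h.1)]
        _ ≤ 2 * ENNReal.ofReal |u x| ^ p * K x y := by
            rw [ENNReal.tsum_mul_right]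
            gcongr
            exact ENNReal.tsum_two_zpow_rpow_le hp ENNReal.ofReal_ne_top
        _ ≤ 2 * (2 * ENNReal.ofReal |u x - u y|) ^ p * K x y := by gcongr
        _ = _ := by
            rw [ENNReal.mul_rpow_of_nonneg _ _ hp0]
            ring
    · have : ∑' i, G i x y = 0 := by
        refine ENNReal.tsum_eq_zero.2 fun i => Set.indicator_of_notMem (fun h => hxy ?_) _
        have h1 : (2 : ℝ≥0∞) ^ i < ENNReal.ofReal |u x| := h.1
        have h2 : ENNReal.ofReal |u y| ≤ (2 : ℝ≥0∞) ^ (i - 1) := not_lt.1 h.2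
        have h3 : ENNReal.ofReal (2 * |u y|) ≤ ENNReal.ofReal |u x| := by
          rw [ENNReal.ofReal_mul (by norm_num)]
          calc _ ≤ 2 * (2 : ℝ≥0∞) ^ (i - 1) := by
                rw [ENNReal.ofReal_ofNat]; gcongr
            _ = 2 ^ i := by rw [← ENNReal.two_zpow_add_one, sub_add_cancel]
            _ ≤ _ := h1.le
        exact (ENNReal.ofReal_le_ofReal_iff (abs_nonneg _)).1 h3
      rw [this]
      exact zero_le
  calc _ = ∑' i, ∫⁻ x, ∫⁻ y, G i x y ∂ν ∂ν := tsum_congr hterm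
    _ = ∫⁻ x, ∫⁻ y, ∑' i, G i x y ∂ν ∂ν := by
        have hGi : ∀ i, Measurable fun x => ∫⁻ y, G i x y ∂ν := fun i =>
          (hGm i).lintegral_prod_right'
        rw [← lintegral_tsum fun i => (hGi i).aemeasurable]
        refine lintegral_congr fun x => ?_
        rw [lintegral_tsum fun i => (hGx i x).aemeasurable]
    _ ≤ ∫⁻ x, ∫⁻ y, 2 * 2 ^ p * (ENNReal.ofReal |u x - u y| ^ p * K x y) ∂ν ∂ν :=
        lintegral_mono fun x => lintegral_mono fun y => hpt x y
    _ = _ := by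
        have hc : (2 : ℝ≥0∞) * 2 ^ p ≠ ⊤ :=
          ENNReal.mul_ne_top (by norm_num) (ENNReal.rpow_ne_top_of_nonneg hp0 (by norm_num))
        rw [← lintegral_const_mul' _ _ hc]
        exact lintegral_congr fun x => lintegral_const_mul' _ _ hc

/-- A Sobolev inequality follows from the corresponding capacity-type inequality for pairs of
nested sets of comparable measure. -/
theorem sobolev_of_nested_sets (μ ν : Measure X) [SFinite ν] {K : X → X → ℝ≥0∞}
    (hK : Measurable (Function.uncurry K)) {p κ : ℝ} (hp : 1 ≤ p) (h0 : 0 < κ) (h1 : κ ≤ 1)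
    {δ D : ℝ≥0∞} (hδ : δ ^ κ * 2 ^ p ≤ 2⁻¹)
    (hsets : ∀ A F : Set X, MeasurableSet A → MeasurableSet F → A ⊆ F → μ F ≠ 0 → μ F ≠ ⊤ →
      δ * μ F ≤ μ A → μ A ^ κ ≤ D * ∫⁻ x in A, ∫⁻ y in Fᶜ, K x y ∂ν ∂ν)
    {u : X → ℝ} (hu : Measurable u) {M : ℝ} (hM : ∀ x, |u x| ≤ M)
    (hsupp : μ (Function.support u) ≠ ⊤) :
    (∫⁻ x, ENNReal.ofReal |u x| ^ (p / κ) ∂μ) ^ κ ≤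
      2 ^ p * (2 * D * (2 * 2 ^ p)) *
        ∫⁻ x, ∫⁻ y, ENNReal.ofReal |u x - u y| ^ p * K x y ∂ν ∂ν := by
  have hp0 : 0 ≤ p := by linarith
  set A : ℤ → Set X := fun i => {x | (2 : ℝ≥0∞) ^ i < ENNReal.ofReal |u x|} with hA
  set y : ℤ → ℝ≥0∞ := fun i => ((2 : ℝ≥0∞) ^ i) ^ p * μ (A i) ^ κ with hy
  set P : ℤ → ℝ≥0∞ := fun i => ((2 : ℝ≥0∞) ^ i) ^ p *
    ∫⁻ x in A i, ∫⁻ y in (A (i - 1))ᶜ, K x y ∂ν ∂ν with hP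
  have hm : ∀ i : ℤ, MeasurableSet (A i) := fun i =>
    measurableSet_lt measurable_const (by fun_prop)
  have hAsupp : ∀ i, μ (A i) ≤ μ (Function.support u) := fun i => by
    refine measure_mono fun x hx h => ?_
    have hx' : (2 : ℝ≥0∞) ^ i < ENNReal.ofReal |u x| := hx
    simp [h] at hx'
  have hsub : ∀ i, A i ⊆ A (i - 1) := fun i x (hx : _ < _) =>
    lt_of_le_of_lt (ENNReal.zpow_le_of_le (by norm_num) (by omega)) hx
  have hstep : ∀ i, y i ≤ D * P i + 2⁻¹ * y (i - 1) := by
    intro i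
    rcases eq_or_ne (μ (A (i - 1))) 0 with hz | hz
    · have : μ (A i) = 0 := measure_mono_null (hsub i) hz
      simp [hy, this, h0]
    rcases le_total (δ * μ (A (i - 1))) (μ (A i)) with h | h
    · refine le_add_right ?_
      have := hsets (A i) (A (i - 1)) (hm _) (hm _) (hsub i) hz
        (ne_top_of_le_ne_top hsupp (hAsupp _)) h
      calc y i ≤ ((2 : ℝ≥0∞) ^ i) ^ p * (D * ∫⁻ x in A i, ∫⁻ y in (A (i - 1))ᶜ, K x y ∂ν ∂ν) := by
            simp only [hy]; gcongr
        _ = D * P i := by simp only [hP]; ring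
    · refine le_add_left ?_
      calc y i ≤ ((2 : ℝ≥0∞) ^ i) ^ p * (δ * μ (A (i - 1))) ^ κ := by
            simp only [hy]; gcongr
        _ = (δ ^ κ * 2 ^ p) * y (i - 1) := by
            have h2 : (2 : ℝ≥0∞) ^ i = 2 * 2 ^ (i - 1) := by
              rw [← ENNReal.two_zpow_add_one, sub_add_cancel]
            simp only [hy]
            rw [h2, ENNReal.mul_rpow_of_nonneg _ _ hp0, ENNReal.mul_rpow_of_nonneg _ _ h0.le]
            ring
        _ ≤ _ := by gcongr
  -- Absorbing half of the sum requires it to be finite; boundedness of u cuts off the large levels.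
  have hfin : ∑' i, y i ≠ ⊤ := by
    have hb : ∑' i, y i ≤ (∑' i : ℤ, (if (2 : ℝ≥0∞) ^ i < ENNReal.ofReal M
        then ((2 : ℝ≥0∞) ^ i) ^ p else 0)) * μ (Function.support u) ^ κ := by
      rw [← ENNReal.tsum_mul_right]
      refine ENNReal.tsum_le_tsum fun i => ?_
      split_ifs with h
      · simp only [hy]
        exact mul_le_mul_right (ENNReal.rpow_le_rpow (hAsupp i) h0.le) _
      · have : A i = ∅ := Set.eq_empty_of_forall_notMem fun x (hx : _ < _) =>
          h (hx.trans_le (ENNReal.ofReal_le_ofReal (hM x)))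
        simp [hy, this, h0]
    refine ne_top_of_le_ne_top ?_ (hb.trans
      (mul_le_mul_left (ENNReal.tsum_two_zpow_rpow_le hp ENNReal.ofReal_ne_top) _))
    exact ENNReal.mul_ne_top (ENNReal.mul_ne_top (by norm_num)
      (ENNReal.rpow_ne_top_of_nonneg hp0 ENNReal.ofReal_ne_top))
      (ENNReal.rpow_ne_top_of_nonneg h0.le hsupp)
  have hY : ∑' i, y i ≤ 2 * D * ∑' i, P i := by
    have hshift : ∑' i, y (i - 1) = ∑' i, y i := (Equiv.subRight (1 : ℤ)).tsum_eq y
    have hle : ∑' i, y i ≤ D * ∑' i, P i + 2⁻¹ * ∑' i, y i := by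
      conv_rhs => rw [← hshift, ← ENNReal.tsum_mul_left, ← ENNReal.tsum_mul_left, ← ENNReal.tsum_add]
      exact ENNReal.tsum_le_tsum hstep
    generalize (∑' i, y i) = Y at *
    have hY2 : Y = 2⁻¹ * Y + 2⁻¹ * Y := by
      rw [← add_mul, ENNReal.inv_two_add_inv_two, one_mul]
    have hhalf : 2⁻¹ * Y ≤ D * ∑' i, P i := by
      refine (ENNReal.add_le_add_iff_right (a := 2⁻¹ * Y)
        (ENNReal.mul_ne_top (by norm_num) hfin)).1 ?_
      rwa [← hY2]
    calc Y = 2 * (2⁻¹ * Y) := by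
          rw [← mul_assoc, ENNReal.mul_inv_cancel (by norm_num) (by norm_num), one_mul]
      _ ≤ 2 * (D * ∑' i, P i) := by gcongr
      _ = _ := by ring
  calc _ ≤ 2 ^ p * ∑' i, y i := rpow_lintegral_le_tsum_dyadic μ
        (v := fun x => ENNReal.ofReal |u x|) (by fun_prop) (fun _ => ENNReal.ofReal_ne_top) hp h0 h1
    _ ≤ 2 ^ p * (2 * D * (2 * 2 ^ p * ∫⁻ x, ∫⁻ y, ENNReal.ofReal |u x - u y| ^ p * K x y ∂ν ∂ν)) := by
        gcongr
        exact hY.trans (by gcongr; exact tsum_dyadic_lintegral_le ν hK hu hp)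
    _ = _ := by ring

end Dyadic


/-! ### The power weight and its kernel. -/

/-- The measure `‖x‖ ^ (-γ) dx`. -/
noncomputable def powerWeightMeasure (N : ℕ) (γ : ℝ) : Measure (EuclideanSpace ℝ (Fin N)) :=
  volume.withDensity fun x => ENNReal.ofReal (‖x‖ ^ (-γ))

/-- The kernel `1 / (‖x - y‖ ^ (N + σ) ‖x‖ ^ β ‖y‖ ^ β)`. -/
noncomputable def weightedGagliardoKernel (N : ℕ) (σ β : ℝ) (x y : EuclideanSpace ℝ (Fin N)) :
    ℝ≥0∞ :=
  ENNReal.ofReal (1 / (‖x - y‖ ^ ((N : ℝ) + σ) * ‖x‖ ^ β * ‖y‖ ^ β))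

lemma measurable_weightedGagliardoKernel (N : ℕ) (σ β : ℝ) :
    Measurable (Function.uncurry (weightedGagliardoKernel N σ β)) := by
  unfold weightedGagliardoKernel Function.uncurry
  fun_prop

section

variable {N : ℕ}

lemma powerWeightMeasure_ball_one_lt_top (hN : 1 ≤ N) {γ : ℝ} (hγ : γ < N) :
    powerWeightMeasure N γ (Metric.ball 0 1) < ⊤ := by
  rw [powerWeightMeasure, withDensity_apply _ measurableSet_ball]
  have h : IntegrableOn (fun x : EuclideanSpace ℝ (Fin N) => ‖x‖ ^ (-γ)) (Metric.ball 0 1) := by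
    refine integrableOn_ball_of_norm_le_rpow (C := 1) (α := γ) (by simpa using hN)
      (by simpa using hγ) (ae_of_all _ fun x => ?_)
      (Measurable.aestronglyMeasurable (by fun_prop))
    rw [one_mul, Real.norm_of_nonneg (by positivity)]
  exact h.lintegral_lt_top

lemma powerWeightMeasure_ball {γ r : ℝ} (hr : 0 < r) :
    powerWeightMeasure N γ (Metric.ball 0 r) =
      ENNReal.ofReal (r ^ (N - γ)) * powerWeightMeasure N γ (Metric.ball 0 1) := by
  simp only [powerWeightMeasure]
  rw [withDensity_apply _ measurableSet_ball, withDensity_apply _ measurableSet_ball,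
    ← lintegral_indicator measurableSet_ball, ← lintegral_indicator measurableSet_ball]
  have hvol : (volume : Measure (EuclideanSpace ℝ (Fin N))) =
      ENNReal.ofReal (r ^ (N : ℝ)) • Measure.map (r • ·) volume := by
    rw [Measure.map_addHaar_smul _ hr.ne', smul_smul, ← ENNReal.ofReal_mul (by positivity)]
    simp [abs_of_pos hr, hr.ne']
  conv_lhs => rw [hvol]
  rw [lintegral_smul_measure, lintegral_map ?_ (measurable_const_smul r), smul_eq_mul,
    sub_eq_add_neg, Real.rpow_add hr, ENNReal.ofReal_mul (by positivity), mul_assoc]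
  · rw [← lintegral_const_mul' _ _ (ENNReal.ofReal_ne_top (r := r ^ (-γ)))]
    congr 1
    refine lintegral_congr fun x => ?_
    by_cases hx : ‖x‖ < 1
    · rw [Set.indicator_of_mem, Set.indicator_of_mem, norm_smul, Real.norm_of_nonneg hr.le,
        Real.mul_rpow hr.le (norm_nonneg _), ENNReal.ofReal_mul (by positivity)]
      · simpa using hx
      · rw [mem_ball_zero_iff, norm_smul, Real.norm_of_nonneg hr.le]
        nlinarith
    · rw [Set.indicator_of_notMem, Set.indicator_of_notMem, mul_zero]
      · simpa using hx
      · rw [mem_ball_zero_iff, norm_smul, Real.norm_of_nonneg hr.le]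
        nlinarith
  · exact Measurable.indicator (by fun_prop) measurableSet_ball

lemma ae_ne_point (hN : 1 ≤ N) (x : EuclideanSpace ℝ (Fin N)) :
    ∀ᵐ y : EuclideanSpace ℝ (Fin N), y ≠ x := by
  have : Nonempty (Fin N) := ⟨⟨0, hN⟩⟩
  exact compl_mem_ae_iff.2 (measure_singleton x)

/-- Inside the ball ‖y‖ ≤ M, so the weight is at least M^(−γ). -/
lemma volume_inter_ball_le (hN : 1 ≤ N) {γ : ℝ} (hγ : 0 ≤ γ) {F : Set (EuclideanSpace ℝ (Fin N))}
    (hF : MeasurableSet F) (x : EuclideanSpace ℝ (Fin N)) {ρ M : ℝ} (hM : ‖x‖ + ρ ≤ M) :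
    volume (F ∩ Metric.ball x ρ) ≤ ENNReal.ofReal (M ^ γ) * powerWeightMeasure N γ F := by
  have hm := hF.inter (Metric.isOpen_ball (x := x) (ε := ρ)).measurableSet
  calc volume (F ∩ Metric.ball x ρ) = ∫⁻ _ in F ∩ Metric.ball x ρ, 1 := by simp
    _ ≤ ∫⁻ y in F ∩ Metric.ball x ρ, ENNReal.ofReal (M ^ γ) * ENNReal.ofReal (‖y‖ ^ (-γ)) := by
        refine setLIntegral_mono_ae (by fun_prop) ?_
        filter_upwards [ae_ne_point hN 0] with y hy0 hy
        have hy1 : 0 < ‖y‖ := norm_pos_iff.2 hy0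
        have hyM : ‖y‖ ≤ M := by
          have h1 := hy.2
          rw [mem_ball_iff_norm] at h1
          have h2 := norm_add_le x (y - x)
          rw [add_sub_cancel] at h2
          linarith
        rw [← ENNReal.ofReal_mul (by positivity [hy1.le.trans hyM]), Real.rpow_neg hy1.le,
          ← div_eq_mul_inv, ENNReal.one_le_ofReal, one_le_div (by positivity)]
        exact Real.rpow_le_rpow hy1.le hyM hγ
    _ ≤ ENNReal.ofReal (M ^ γ) * powerWeightMeasure N γ F := by
        rw [lintegral_const_mul' _ _ ENNReal.ofReal_ne_top, powerWeightMeasure,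
          withDensity_apply _ hF]
        gcongr
        exact Set.inter_subset_left

/-! ### The set inequality. -/

/-- If `F` fills at most half of the ball `B(x, ρ)`, the potential of the complement of `F` at `x`
is bounded below. -/
lemma le_lintegral_compl_kernel (hN : 1 ≤ N) {σ β γ : ℝ} (hσ : 0 ≤ σ) (hβ : 0 ≤ β) (hγ : 0 ≤ γ)
    {F : Set (EuclideanSpace ℝ (Fin N))} (hF : MeasurableSet F) {f : ℝ}
    (hf : powerWeightMeasure N γ F ≤ ENNReal.ofReal f)
    {x : EuclideanSpace ℝ (Fin N)} (hx : x ≠ 0) {ρ M w : ℝ} (hρ : 0 < ρ) (hM : ‖x‖ + ρ ≤ M)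
    (hw : volume (Metric.ball (0 : EuclideanSpace ℝ (Fin N)) 1) = ENNReal.ofReal w)
    (hfρ : M ^ γ * f ≤ w / 2 * ρ ^ (N : ℝ)) :
    ENNReal.ofReal (w / 2 * ρ ^ (-σ) * ‖x‖ ^ (-β) * M ^ (-β)) ≤
      ∫⁻ y in Fᶜ, weightedGagliardoKernel N σ β x y := by
  have : Nonempty (Fin N) := ⟨⟨0, hN⟩⟩
  have hx0 : 0 < ‖x‖ := norm_pos_iff.2 hx
  have hM0 : 0 < M := by linarith
  set B := Metric.ball x ρ with hB
  have hBm : MeasurableSet B := Metric.isOpen_ball.measurableSet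
  have hvolB : volume B = ENNReal.ofReal (w * ρ ^ (N : ℝ)) := by
    rw [hB, Measure.addHaar_ball _ _ hρ.le, hw, ← ENNReal.ofReal_mul (by positivity)]
    simp [mul_comm]
  have hFB : volume (F ∩ B) ≤ ENNReal.ofReal (w / 2 * ρ ^ (N : ℝ)) := by
    refine (volume_inter_ball_le hN hγ hF x hM).trans ?_
    refine (mul_le_mul_right hf _).trans ?_
    rw [← ENNReal.ofReal_mul (by positivity)]
    exact ENNReal.ofReal_le_ofReal hfρ
  have hFcB : ENNReal.ofReal (w / 2 * ρ ^ (N : ℝ)) ≤ volume (Fᶜ ∩ B) := by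
    have h1 : volume B ≤ volume (F ∩ B) + volume (Fᶜ ∩ B) := by
      refine (measure_mono ?_).trans (measure_union_le _ _)
      intro y hy
      by_cases hyF : y ∈ F
      · exact Or.inl ⟨hyF, hy⟩
      · exact Or.inr ⟨hyF, hy⟩
    rw [hvolB] at h1
    have h2 : ENNReal.ofReal (w * ρ ^ (N : ℝ)) ≤
        volume (Fᶜ ∩ B) + ENNReal.ofReal (w / 2 * ρ ^ (N : ℝ)) := by
      rw [add_comm]
      exact h1.trans (by gcongr)
    have h3 := tsub_le_iff_right.2 h2
    by_cases hw0 : 0 ≤ w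
    · rw [← ENNReal.ofReal_sub _ (by positivity)] at h3
      convert h3 using 2
      ring
    · rw [ENNReal.ofReal_of_nonpos]
      · exact zero_le
      · have : 0 < ρ ^ (N : ℝ) := by positivity
        nlinarith
  have hρN : ρ ^ (N : ℝ) * ρ ^ (-((N : ℝ) + σ)) = ρ ^ (-σ) := by
    rw [← Real.rpow_add hρ]; congr 1; ring
  calc ENNReal.ofReal (w / 2 * ρ ^ (-σ) * ‖x‖ ^ (-β) * M ^ (-β))
      = ENNReal.ofReal (ρ ^ (-((N : ℝ) + σ)) * ‖x‖ ^ (-β) * M ^ (-β)) *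
          ENNReal.ofReal (w / 2 * ρ ^ (N : ℝ)) := by
        rw [← ENNReal.ofReal_mul (by positivity), ← hρN]
        congr 1; ring
    _ ≤ ENNReal.ofReal (ρ ^ (-((N : ℝ) + σ)) * ‖x‖ ^ (-β) * M ^ (-β)) * volume (Fᶜ ∩ B) := by
        gcongr
    _ = ∫⁻ _ in Fᶜ ∩ B, ENNReal.ofReal (ρ ^ (-((N : ℝ) + σ)) * ‖x‖ ^ (-β) * M ^ (-β)) := by
        simp
    _ ≤ ∫⁻ y in Fᶜ ∩ B, weightedGagliardoKernel N σ β x y := by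
        refine setLIntegral_mono_ae
          ((measurable_weightedGagliardoKernel N σ β).comp measurable_prodMk_left).aemeasurable ?_
        filter_upwards [ae_ne_point hN 0, ae_ne_point hN x] with y hy0 hyx hy
        have hy1 : 0 < ‖y‖ := norm_pos_iff.2 hy0
        have hxy : 0 < ‖x - y‖ := norm_pos_iff.2 (sub_ne_zero.2 hyx.symm)
        have hxyρ : ‖x - y‖ ≤ ρ := by
          rw [norm_sub_rev]; exact (mem_ball_iff_norm.1 hy.2).le
        have hyM : ‖y‖ ≤ M := by
          have h2 := norm_sub_le x (x - y)
          rw [sub_sub_cancel] at h2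
          linarith
        refine ENNReal.ofReal_le_ofReal ?_
        rw [Real.rpow_neg hρ.le, Real.rpow_neg hx0.le, Real.rpow_neg hM0.le, ← mul_inv, ← mul_inv,
          ← one_div]
        gcongr
    _ ≤ _ := lintegral_mono_set Set.inter_subset_left

/-- Points that are not too close to the origin, relative to the measure of `F`. -/
lemma exists_le_lintegral_compl_kernel (hN : 1 ≤ N) {σ β γ : ℝ} (hσ : 0 ≤ σ) (hβ : 0 ≤ β)
    (hγ : 0 ≤ γ) (hγN : γ < N) (hrel : γ * (1 - σ / N) = 2 * β) {b : ℝ} (hb : 1 ≤ b) :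
    ∃ c : ℝ, 0 < c ∧ ∀ (F : Set (EuclideanSpace ℝ (Fin N))) (f : ℝ)
      (x : EuclideanSpace ℝ (Fin N)), MeasurableSet F → 0 < f →
      powerWeightMeasure N γ F ≤ ENNReal.ofReal f → x ≠ 0 → f ≤ b * ‖x‖ ^ (N - γ) →
      ENNReal.ofReal (c * f ^ (-σ / N)) * ENNReal.ofReal (‖x‖ ^ (-γ)) ≤
        ∫⁻ y in Fᶜ, weightedGagliardoKernel N σ β x y := by
  have hNR : (1 : ℝ) ≤ N := by exact_mod_cast hN
  have hNp : (0 : ℝ) < N := by linarith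
  have hNγ : 0 < N - γ := by linarith
  have : Nonempty (Fin N) := ⟨⟨0, hN⟩⟩
  set w := (volume (Metric.ball (0 : EuclideanSpace ℝ (Fin N)) 1)).toReal with hwdef
  have hw : volume (Metric.ball (0 : EuclideanSpace ℝ (Fin N)) 1) = ENNReal.ofReal w :=
    (ENNReal.ofReal_toReal measure_ball_lt_top.ne).symm
  have hw0 : 0 < w :=
    ENNReal.toReal_pos (Metric.measure_ball_pos volume _ one_pos).ne' measure_ball_lt_top.ne
  have hb0 : 0 < b := by linarith
  -- T^(N−γ) ≥ (2b)^γ · 2/w is what makes F fill at most half of B(x, ρ) when M = 2Tb‖x‖; this uses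
  -- γ < N.
  set T := max 1 ((2 / w * (2 * b) ^ γ) ^ (1 / (N - γ))) with hT
  have hT1 : 1 ≤ T := le_max_left _ _
  have hT0 : 0 < T := by linarith
  have hTγ : (2 * b) ^ γ * 2 / w ≤ T ^ (N - γ) := by
    calc (2 * b) ^ γ * 2 / w = ((2 / w * (2 * b) ^ γ) ^ (1 / (N - γ))) ^ (N - γ) := by
          rw [← Real.rpow_mul (by positivity), one_div_mul_cancel hNγ.ne', Real.rpow_one]
          ring
      _ ≤ T ^ (N - γ) := Real.rpow_le_rpow (by positivity) (le_max_right _ _) hNγ.le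
  refine ⟨w / 2 * T ^ (-σ) * (2 * T * b) ^ (-β), by positivity, ?_⟩
  intro F f x hF hf hFf hx hfx
  have hx0 : 0 < ‖x‖ := norm_pos_iff.2 hx
  set ρ := T * (f * ‖x‖ ^ γ) ^ (1 / (N : ℝ)) with hρ
  have hρ0 : 0 < ρ := by positivity
  -- The hypothesis f ≤ b‖x‖^(N−γ) enters here: ρ is at most a multiple of ‖x‖, so M can be taken
  -- comparable to ‖x‖.
  have hρx : ρ ≤ T * b * ‖x‖ := by
    rw [hρ, mul_assoc]
    gcongr
    have h1 : f * ‖x‖ ^ γ ≤ (b * ‖x‖) ^ (N : ℝ) := by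
      calc f * ‖x‖ ^ γ ≤ b * ‖x‖ ^ (N - γ) * ‖x‖ ^ γ := by gcongr
        _ = b ^ (1 : ℝ) * ‖x‖ ^ (N : ℝ) := by
            rw [mul_assoc, ← Real.rpow_add hx0, sub_add_cancel, Real.rpow_one]
        _ ≤ b ^ (N : ℝ) * ‖x‖ ^ (N : ℝ) := by gcongr
        _ = _ := (Real.mul_rpow hb0.le hx0.le).symm
    calc (f * ‖x‖ ^ γ) ^ (1 / (N : ℝ)) ≤ ((b * ‖x‖) ^ (N : ℝ)) ^ (1 / (N : ℝ)) :=
          Real.rpow_le_rpow (by positivity) h1 (by positivity)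
      _ = b * ‖x‖ := by
          rw [← Real.rpow_mul (by positivity), mul_one_div_cancel hNp.ne', Real.rpow_one]
  have hM : ‖x‖ + ρ ≤ 2 * T * b * ‖x‖ := by
    have : 1 ≤ T * b := one_le_mul_of_one_le_of_one_le hT1 hb
    nlinarith
  have hρpow : ρ ^ (N : ℝ) = T ^ (N : ℝ) * (f * ‖x‖ ^ γ) := by
    rw [hρ, Real.mul_rpow hT0.le (by positivity), ← Real.rpow_mul (by positivity),
      one_div_mul_cancel hNp.ne', Real.rpow_one]
  have hρσ : ρ ^ (-σ) = T ^ (-σ) * (f ^ (-σ / N) * ‖x‖ ^ (γ * (-σ / N))) := by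
    rw [hρ, Real.mul_rpow hT0.le (by positivity), ← Real.rpow_mul (by positivity),
      Real.mul_rpow hf.le (by positivity), ← Real.rpow_mul hx0.le,
      show 1 / (N : ℝ) * -σ = -σ / N by ring]
  have hfρ : (2 * T * b * ‖x‖) ^ γ * f ≤ w / 2 * ρ ^ (N : ℝ) := by
    have h1 : (2 * b) ^ γ ≤ w / 2 * T ^ (N - γ) := by
      rw [div_le_iff₀ hw0] at hTγ; linarith
    rw [hρpow, show 2 * T * b * ‖x‖ = T * (2 * b) * ‖x‖ by ring,
      Real.mul_rpow (by positivity) hx0.le, Real.mul_rpow hT0.le (by positivity)]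
    calc T ^ γ * (2 * b) ^ γ * ‖x‖ ^ γ * f ≤ T ^ γ * (w / 2 * T ^ (N - γ)) * ‖x‖ ^ γ * f := by
          gcongr
      _ = w / 2 * ((T ^ γ * T ^ (N - γ)) * (f * ‖x‖ ^ γ)) := by ring
      _ = _ := by rw [← Real.rpow_add hT0, add_sub_cancel]
  refine le_trans (le_of_eq ?_)
    (le_lintegral_compl_kernel hN hσ hβ hγ hF hFf hx hρ0 hM hw hfρ)
  rw [← ENNReal.ofReal_mul (by positivity), hρσ, Real.mul_rpow (by positivity) hx0.le]
  -- The relation γ(1 − σ/N) = 2β is exactly the matching of these exponents.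
  have hxpow : ‖x‖ ^ (-γ) = ‖x‖ ^ (γ * (-σ / N)) * ‖x‖ ^ (-β) * ‖x‖ ^ (-β) := by
    rw [← Real.rpow_add hx0, ← Real.rpow_add hx0]
    congr 1
    linear_combination -hrel
  rw [hxpow]
  congr 1
  ring

lemma exists_rpow_measure_le_interaction (hN : 1 ≤ N) {σ β γ : ℝ} (hσ : 0 ≤ σ) (hβ : 0 ≤ β)
    (hγ : 0 ≤ γ) (hγN : γ < N) (hσN : σ < N) (hrel : γ * (1 - σ / N) = 2 * β) {δ : ℝ}
    (hδ : 0 < δ) :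
    ∃ D : ℝ≥0∞, D ≠ ⊤ ∧ ∀ A F : Set (EuclideanSpace ℝ (Fin N)), MeasurableSet A →
      MeasurableSet F → A ⊆ F → powerWeightMeasure N γ F ≠ 0 → powerWeightMeasure N γ F ≠ ⊤ →
      ENNReal.ofReal δ * powerWeightMeasure N γ F ≤ powerWeightMeasure N γ A →
      powerWeightMeasure N γ A ^ (1 - σ / N) ≤
        D * ∫⁻ x in A, ∫⁻ y in Fᶜ, weightedGagliardoKernel N σ β x y := by
  have hNR : (1 : ℝ) ≤ N := by exact_mod_cast hN
  have hNp : (0 : ℝ) < N := by linarith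
  have hNγ : 0 < N - γ := by linarith
  have hκ : 0 ≤ 1 - σ / N := by
    rw [sub_nonneg, div_le_one hNp]; exact hσN.le
  set C := max 1 (powerWeightMeasure N γ (Metric.ball 0 1)).toReal with hC
  have hC0 : 0 < C := lt_of_lt_of_le one_pos (le_max_left _ _)
  have hball : powerWeightMeasure N γ (Metric.ball 0 1) ≤ ENNReal.ofReal C := by
    rw [← ENNReal.ofReal_toReal (powerWeightMeasure_ball_one_lt_top hN hγN).ne]
    exact ENNReal.ofReal_le_ofReal (le_max_right _ _)
  obtain ⟨c, hc, hpot⟩ := exists_le_lintegral_compl_kernel hN hσ hβ hγ hγN hrel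
    (b := max 1 (2 * C / δ)) (le_max_left _ _)
  refine ⟨ENNReal.ofReal (2 / (c * δ)), ENNReal.ofReal_ne_top, ?_⟩
  intro A F hA hF hAF hF0 hFtop hAδ
  set f := (powerWeightMeasure N γ F).toReal with hf
  have hFf : powerWeightMeasure N γ F = ENNReal.ofReal f := (ENNReal.ofReal_toReal hFtop).symm
  have hf0 : 0 < f := ENNReal.toReal_pos hF0 hFtop
  -- With this radius B(0, r) carries at most half of δf, and f = (2C/δ) r^(N−γ), which explains the
  -- choice of b.
  set r := (δ * f / (2 * C)) ^ (1 / (N - γ)) with hr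
  have hr0 : 0 < r := by positivity
  have hrpow : r ^ (N - γ) = δ * f / (2 * C) := by
    rw [hr, ← Real.rpow_mul (by positivity), one_div_mul_cancel hNγ.ne', Real.rpow_one]
  have hballr : powerWeightMeasure N γ (Metric.ball 0 r) ≤ ENNReal.ofReal (δ * f / 2) := by
    rw [powerWeightMeasure_ball hr0]
    refine (mul_le_mul_right hball _).trans ?_
    rw [← ENNReal.ofReal_mul (by positivity), hrpow]
    refine ENNReal.ofReal_le_ofReal (le_of_eq ?_)
    field_simp
  have hdiff : ENNReal.ofReal (δ * f / 2) ≤ powerWeightMeasure N γ (A \ Metric.ball 0 r) := by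
    have h1 : ENNReal.ofReal (δ * f) ≤ powerWeightMeasure N γ (A \ Metric.ball 0 r) +
        ENNReal.ofReal (δ * f / 2) := by
      rw [ENNReal.ofReal_mul hδ.le, ← hFf]
      refine hAδ.trans ((measure_le_inter_add_sdiff _ A (Metric.ball 0 r)).trans ?_)
      rw [add_comm]
      gcongr
      exact (measure_mono Set.inter_subset_right).trans hballr
    have h2 := tsub_le_iff_right.2 h1
    rw [← ENNReal.ofReal_sub _ (by positivity)] at h2
    convert h2 using 2
    ring
  have hmd : MeasurableSet (A \ Metric.ball 0 r) := hA.diff measurableSet_ball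
  have hlow : ENNReal.ofReal (c * f ^ (-σ / N)) * ENNReal.ofReal (δ * f / 2) ≤
      ∫⁻ x in A, ∫⁻ y in Fᶜ, weightedGagliardoKernel N σ β x y := by
    calc _ ≤ ENNReal.ofReal (c * f ^ (-σ / N)) *
          powerWeightMeasure N γ (A \ Metric.ball 0 r) := by gcongr
      _ = ∫⁻ x in A \ Metric.ball 0 r,
          ENNReal.ofReal (c * f ^ (-σ / N)) * ENNReal.ofReal (‖x‖ ^ (-γ)) := by
          rw [lintegral_const_mul' _ _ ENNReal.ofReal_ne_top, powerWeightMeasure,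
            withDensity_apply _ hmd]
      _ ≤ ∫⁻ x in A \ Metric.ball 0 r, ∫⁻ y in Fᶜ, weightedGagliardoKernel N σ β x y := by
          refine setLIntegral_mono' hmd fun x hx => ?_
          have hxr : r ≤ ‖x‖ := by simpa using hx.2
          refine hpot F f x hF hf0 hFf.le (norm_pos_iff.1 (hr0.trans_le hxr)) ?_
          calc f = 2 * C / δ * r ^ (N - γ) := by rw [hrpow]; field_simp
            _ ≤ max 1 (2 * C / δ) * ‖x‖ ^ (N - γ) := by
                gcongr
                exact le_max_right _ _
      _ ≤ _ := lintegral_mono_set Set.sdiff_subset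
  calc powerWeightMeasure N γ A ^ (1 - σ / N) ≤ powerWeightMeasure N γ F ^ (1 - σ / N) := by
        gcongr
    _ = ENNReal.ofReal (2 / (c * δ)) *
        (ENNReal.ofReal (c * f ^ (-σ / N)) * ENNReal.ofReal (δ * f / 2)) := by
        rw [hFf, ENNReal.ofReal_rpow_of_pos hf0, ← ENNReal.ofReal_mul (by positivity),
          ← ENNReal.ofReal_mul (by positivity), show 1 - σ / N = -σ / N + 1 by ring,
          Real.rpow_add_one hf0.ne']
        congr 1
        field_simp
    _ ≤ _ := by gcongr

end

/-! ### The weighted fractional Sobolev inequality. -/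

theorem theorem1p5 (N : ℕ) (s p β : ℝ) (hs0 : 0 < s) (hs1 : s < 1)
    (hp1 : 1 < p) (hpN : p < N / s) (hβ0 : 0 < β) (hβ1 : β < (N - p * s) / 2) :
    ∃ S : ℝ, 0 < S ∧
      ∀ u : EuclideanSpace ℝ (Fin N) → ℝ, ContDiff ℝ ∞ u → HasCompactSupport u →
        ENNReal.ofReal S *
            weightedCriticalIntegral N s p β u ^ (p / fracSobolevExponent N s p) ≤
          weightedGagliardoEnergy N s p β u := by
  have hσN : p * s < N := (lt_div_iff₀ hs0).1 hpN
  have hσ : 0 < p * s := by positivity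
  have hNp : (0 : ℝ) < N := hσ.trans hσN
  have hN : 1 ≤ N := by exact_mod_cast hNp
  have hd : 0 < N - p * s := by linarith
  have hp0 : 0 < p := by linarith
  set κ := 1 - p * s / N with hκdef
  have hκ0 : 0 < κ := by rw [hκdef, sub_pos, div_lt_one hNp]; exact hσN
  have hκ1 : κ ≤ 1 := by
    have : 0 ≤ p * s / N := by positivity
    linarith
  have hκd : κ = (N - p * s) / N := by rw [hκdef]; field_simp
  have hq : fracSobolevExponent N s p = p / κ := by
    rw [fracSobolevExponent, hκd]; field_simp
  set γ := 2 * β * (fracSobolevExponent N s p / p) with hγdef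
  have hγκ : γ = 2 * β / κ := by rw [hγdef, hq]; field_simp
  have hγ0 : 0 ≤ γ := by rw [hγκ]; positivity
  have hγN : γ < N := by
    rw [hγκ, div_lt_iff₀ hκ0, hκd]
    field_simp
    linarith
  have hrel : γ * (1 - p * s / N) = 2 * β := by
    rw [hγκ, ← hκdef]; field_simp
  -- The solution of δ^κ · 2^p = 1/2, the absorption threshold.
  set δ : ℝ := (2⁻¹ / 2 ^ p) ^ (1 / κ) with hδdef
  have hδ0 : 0 < δ := by positivity
  have hδ : ENNReal.ofReal δ ^ κ * 2 ^ p ≤ 2⁻¹ := by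
    rw [ENNReal.ofReal_rpow_of_pos hδ0, hδdef, ← Real.rpow_mul (by positivity),
      one_div_mul_cancel hκ0.ne', Real.rpow_one,
      show (2 : ℝ≥0∞) = ENNReal.ofReal 2 by simp, ENNReal.ofReal_rpow_of_pos (by norm_num),
      ← ENNReal.ofReal_mul (by positivity), div_mul_cancel₀ _ (by positivity),
      ENNReal.ofReal_inv_of_pos (by norm_num)]
  obtain ⟨D, hD, hsets⟩ := exists_rpow_measure_le_interaction hN hσ.le hβ0.le hγ0 hγN hσN hrel hδ0
  set C : ℝ≥0∞ := 2 ^ p * (2 * D * (2 * 2 ^ p)) with hC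
  have h2p : (2 : ℝ≥0∞) ^ p ≠ ⊤ := ENNReal.rpow_ne_top_of_nonneg hp0.le (by norm_num)
  have hCtop : C ≠ ⊤ := by finiteness
  have hS : 0 < 1 / (C.toReal + 1) := by positivity
  -- Adding 1 keeps the denominator positive without checking that C ≠ 0.
  refine ⟨1 / (C.toReal + 1), hS, fun u hu hcu => ?_⟩
  have huc : Continuous u := hu.continuous
  obtain ⟨M, hM⟩ := huc.bounded_above_of_compact_support hcu
  have hsupp : powerWeightMeasure N γ (Function.support u) ≠ ⊤ := by
    obtain ⟨R, hR0, hR⟩ := hcu.isBounded.exists_pos_norm_lt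
    refine ne_top_of_le_ne_top (b := powerWeightMeasure N γ (Metric.ball 0 R)) ?_
      (measure_mono fun x hx => ?_)
    · rw [powerWeightMeasure_ball hR0]
      exact ENNReal.mul_ne_top ENNReal.ofReal_ne_top (powerWeightMeasure_ball_one_lt_top hN hγN).ne
    · simpa using hR x (subset_tsupport u hx)
  have hmain := sobolev_of_nested_sets (powerWeightMeasure N γ) volume
    (measurable_weightedGagliardoKernel N (p * s) β) hp1.le hκ0 hκ1 hδ hsets huc.measurable
    (M := M) hM hsupp
  have hright : ∫⁻ x, ∫⁻ y, ENNReal.ofReal |u x - u y| ^ p *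
      weightedGagliardoKernel N (p * s) β x y = weightedGagliardoEnergy N s p β u := by
    refine lintegral_congr fun x => lintegral_congr fun y => ?_
    rw [weightedGagliardoKernel, ENNReal.ofReal_rpow_of_nonneg (abs_nonneg _) hp0.le,
      ← ENNReal.ofReal_mul (by positivity), mul_one_div]
  have hleft : ∫⁻ x, ENNReal.ofReal |u x| ^ (p / κ) ∂(powerWeightMeasure N γ) =
      weightedCriticalIntegral N s p β u := by
    rw [powerWeightMeasure, lintegral_withDensity_eq_lintegral_mul _ (by fun_prop) (by fun_prop)]
    refine lintegral_congr fun x => ?_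
    rw [Pi.mul_apply, ENNReal.ofReal_rpow_of_nonneg (abs_nonneg _) (by positivity),
      ← ENNReal.ofReal_mul (by positivity), Real.rpow_neg (norm_nonneg _), ← hγdef, hq, mul_comm,
      ← div_eq_mul_inv]
  rw [hright, hleft] at hmain
  have hexp : p / fracSobolevExponent N s p = κ := by rw [hq]; field_simp
  rw [hexp]
  calc _ ≤ ENNReal.ofReal (1 / (C.toReal + 1)) * (C * weightedGagliardoEnergy N s p β u) := by
        gcongr
    _ ≤ 1 * weightedGagliardoEnergy N s p β u := by
        rw [← mul_assoc]
        gcongr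
        nth_rw 2 [← ENNReal.ofReal_toReal hCtop]
        rw [← ENNReal.ofReal_mul hS.le, ENNReal.ofReal_le_one, one_div, inv_mul_le_one₀ (by positivity)]
        linarith
    _ = _ := one_mul _
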